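/- Let $p>1$ be real and let $m\ge 1$, $N\ge 2m-1$ and $s\in\{1,\dots,N\}$ be integers. For $x\in\mathbb R^N$ put $\|x\|_p=\big(\sum_{i=1}^N|x_i|^p\big)^{1/p}$ and $\mathrm{supp}(x)=\{i : x_i\neq 0\}$. For $A\in\mathbb R^{m\times N}$ and $y\in\mathbb R^m$, let $\mathrm{BP}_p(A,y)$ denote the problem $$\min_{x\in\mathbb R^N}\ \|x\|_p\quad\text{subject to}\quad Ax=y .$$ For $\mathcal I\subseteq\{1,\dots,N\}$ let $A_{\bullet\mathcal I}$ be the submatrix of $A$ formed by the columns indexed by $\mathcal I$, and let $R(A_{\bullet\mathcal I})\subseteq\mathbb R^m$ be its range. Then the following hold. (i) There exists a set $S_A\subset\mathbb R^{m\times N}$ whose complement has Lebesgue measure zero such that for each $A\in S_A$, each index set $\mathcal I$ with $|\mathcal I|\le s$, and each nonzero $y\in R(A_{\bullet\mathcal I})$, the problem $\mathrm{BP}_p(A,y)$ has a unique optimal solution $x^*$, and $|\mathrm{supp}(x^*)|\ge N-m+1$. (ii) There exists a set $\widehat S_A\subset\mathbb R^{m\times N}$ whose complement has Lebesgue measure zero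 such that for each $A\in\widehat S_A$ and each nonempty index set $\mathcal I$ with $|\mathcal I|\le s$, for almost every $y\in R(A_{\bullet\mathcal I})$ (with respect to Lebesgue measure on the subspace $R(A_{\bullet\mathcal I})$), the problem $\mathrm{BP}_p(A,y)$ has a unique optimal solution $x^*$, and $|\mathrm{supp}(x^*)|=N$. -/

import Mathlib

open MeasureTheory

/-- The `p`-norm `‖x‖_p = (∑ i, |x i| ^ p) ^ (1 / p)` on `ℝ^N`, for a real exponent `p > 0`. -/
noncomputable def pNorm {N : ℕ} (p : ℝ) (x : Fin N → ℝ) : ℝ :=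
  (∑ i, |x i| ^ p) ^ (1 / p)

/-- `x` is an optimal solution of the generalized basis pursuit problem
`min ‖x‖_p` subject to `A x = y`. -/
def IsBPSolution {m N : ℕ} (p : ℝ) (A : Matrix (Fin m) (Fin N) ℝ) (y : Fin m → ℝ)
    (x : Fin N → ℝ) : Prop :=
  A.mulVec x = y ∧ ∀ z : Fin N → ℝ, A.mulVec z = y → pNorm p x ≤ pNorm p z

/-- The size of the support of a vector. -/
noncomputable def suppCard {N : ℕ} (x : Fin N → ℝ) : ℕ :=
  (Function.support x).ncard

/-- The submatrix of `A` formed by the columns with index in `I`. -/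
def colSubmatrix {m N : ℕ} (A : Matrix (Fin m) (Fin N) ℝ) (I : Finset (Fin N)) :
    Matrix (Fin m) I ℝ :=
  A.submatrix id Subtype.val

/-- The range of the submatrix of `A` formed by the columns with index in `I`, as a subspace of
Euclidean space. As a finite-dimensional inner product space it carries its own
Lebesgue measure `volume`. -/
noncomputable def colRange {m N : ℕ} (A : Matrix (Fin m) (Fin N) ℝ) (I : Finset (Fin N)) :
    Submodule ℝ (EuclideanSpace ℝ (Fin m)) :=
  LinearMap.range (Matrix.toEuclideanLin (colSubmatrix A I))

/-- The complement of the set `S` of real `m × N` matrices has zero Lebesgue measure, where the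
space of matrices is identified, entry by entry, with `m * N` copies of `ℝ`. -/
def HasNullComplement {m N : ℕ} (S : Set (Matrix (Fin m) (Fin N) ℝ)) : Prop :=
  (volume : Measure (Fin m → Fin N → ℝ)) {a | Matrix.of a ∉ S} = 0

/-! With `r = 1 / (p - 1)`, stationarity forces an optimal `x` to be the entrywise signed `r`-th
power of `Aᵀu` for some `u`. Strict monotonicity of that power makes `x` unique, and `x i = 0`
exactly when `u` is orthogonal to column `i`.

For (i), if all maximal minors are nonzero, a nonzero `u` is orthogonal to fewer than `m` columns.

For (ii), fix coefficients `w`, put `y = A w`, and vary only column `c` of index `j`. If `u` is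
orthogonal to `c`, that column drops out of the dual map, leaving `B (dualPoint r B u) = B w + w j •
c`, where `B` is `A` with column `j` cleared. If `w j = 0`, this fixes `u`, so `c` lies in a
hyperplane. Otherwise `c` is a function of `u`, and pairing with `u` confines `u` to a null set
whose image is again null (`volume_column_hasDualZero`). Fubini then exchanges `A` and `w`, and a
surjective linear map carries the result to the column range. -/

/-! ### Signed powers -/

/-- The odd power function `t ↦ sign t * |t| ^ r`. -/
noncomputable def signedPow (r t : ℝ) : ℝ := max t 0 ^ r - max (-t) 0 ^ r

lemma signedPow_neg (r t : ℝ) : signedPow r (-t) = -signedPow r t := by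
  simp [signedPow]

lemma signedPow_of_nonneg {r t : ℝ} (hr : r ≠ 0) (ht : 0 ≤ t) : signedPow r t = t ^ r := by
  simp [signedPow, ht, Real.zero_rpow hr]

lemma signedPow_zero {r : ℝ} : signedPow r 0 = 0 := by
  simp [signedPow]

lemma continuous_signedPow {r : ℝ} (hr : 0 < r) : Continuous (signedPow r) := by
  unfold signedPow
  have h := Real.continuous_rpow_const hr.le
  exact (h.comp (continuous_id.max continuous_const)).sub
    (h.comp (continuous_neg.max continuous_const))

lemma strictMono_signedPow {r : ℝ} (hr : 0 < r) : StrictMono (signedPow r) := by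
  intro s t hst
  unfold signedPow
  have h1 : max s 0 ^ r ≤ max t 0 ^ r :=
    Real.rpow_le_rpow (le_max_right _ _) (max_le_max_right _ hst.le) hr.le
  have h2 : max (-t) 0 ^ r ≤ max (-s) 0 ^ r :=
    Real.rpow_le_rpow (le_max_right _ _) (max_le_max_right _ (by linarith)) hr.le
  rcases lt_or_ge 0 t with ht | ht
  · have : max s 0 ^ r < max t 0 ^ r := by
      refine Real.rpow_lt_rpow (le_max_right _ _) ?_ hr
      rw [max_eq_left ht.le]
      exact max_lt hst ht
    linarith
  · have : max (-t) 0 ^ r < max (-s) 0 ^ r := by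
      refine Real.rpow_lt_rpow (le_max_right _ _) ?_ hr
      rw [max_eq_left (by linarith : 0 ≤ -s)]
      exact max_lt (by linarith) (by linarith)
    linarith

lemma differentiableAt_signedPow {r t : ℝ} (hr : r ≠ 0) (ht : t ≠ 0) :
    DifferentiableAt ℝ (signedPow r) t := by
  have key : ∀ s : ℝ, 0 < s → DifferentiableAt ℝ (signedPow r) s := fun s hs =>
    (Real.differentiableAt_rpow_const_of_ne r hs.ne').congr_of_eventuallyEq
      ((eventually_gt_nhds hs).mono fun x hx => signedPow_of_nonneg hr hx.le)
  rcases ht.lt_or_gt with h | h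
  · have h1 : signedPow r = fun x => -signedPow r (-x) := by
      funext x; rw [signedPow_neg, neg_neg]
    rw [h1]
    exact ((key (-t) (by linarith)).comp t differentiableAt_id.neg).neg
  · exact key t h

lemma mul_signedPow {r : ℝ} (hr : 0 < r) (t : ℝ) : t * signedPow r t = |t| ^ (r + 1) := by
  have key : ∀ s : ℝ, 0 ≤ s → s * signedPow r s = |s| ^ (r + 1) := fun s hs => by
    rw [signedPow_of_nonneg hr.ne' hs, abs_of_nonneg hs, Real.rpow_add_one' hs (by positivity),
      mul_comm]
  rcases le_total 0 t with h | h
  · exact key t h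
  · have := key (-t) (by linarith)
    rwa [signedPow_neg, neg_mul_neg, abs_neg] at this

/-- Up to the factor `p`, `|t| ^ (p - 2) * t` is the derivative of `|t| ^ p`; inverting it solves
the stationarity equation for `x`. -/
lemma signedPow_inverse {p : ℝ} (hp : 1 < p) (t : ℝ) :
    signedPow (1 / (p - 1)) (|t| ^ (p - 2) * t) = t := by
  have hp' : 0 < p - 1 := by linarith
  have key : ∀ s : ℝ, 0 ≤ s → signedPow (1 / (p - 1)) (|s| ^ (p - 2) * s) = s := fun s hs => by
    rw [abs_of_nonneg hs, signedPow_of_nonneg (by positivity) (by positivity)]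
    rcases hs.eq_or_lt with rfl | hs
    · rw [mul_zero, Real.zero_rpow (by positivity)]
    · rw [← Real.rpow_add_one hs.ne', ← Real.rpow_mul hs.le,
        show (p - 2 + 1) * (1 / (p - 1)) = 1 by field_simp; ring, Real.rpow_one]
  rcases le_total 0 t with h | h
  · exact key t h
  · have := key (-t) (by linarith)
    rw [abs_neg, mul_neg, signedPow_neg] at this
    linarith

/-! ### Optimality condition, existence and uniqueness -/

/-- The vector whose `i`-th entry is the signed power of the `i`-th entry of `Aᵀ u`. -/
noncomputable def dualPoint {m N : ℕ} (r : ℝ) (A : Matrix (Fin m) (Fin N) ℝ) (u : Fin m → ℝ) :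
    Fin N → ℝ :=
  fun i => signedPow r (Matrix.vecMul u A i)

/-- Pairing the difference of the two images with `u - v` gives a vanishing sum of terms that
monotonicity makes nonnegative, so each term is zero. -/
lemma dualPoint_unique {m N : ℕ} {r : ℝ} (hr : 0 < r) {A : Matrix (Fin m) (Fin N) ℝ}
    {u v : Fin m → ℝ} (h : A.mulVec (dualPoint r A u) = A.mulVec (dualPoint r A v)) :
    Matrix.vecMul u A = Matrix.vecMul v A := by
  have hsum : ∑ i, (Matrix.vecMul u A i - Matrix.vecMul v A i) *
      (signedPow r (Matrix.vecMul u A i) - signedPow r (Matrix.vecMul v A i)) = 0 := by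
    have h1 : Matrix.vecMul (u - v) A ⬝ᵥ (dualPoint r A u - dualPoint r A v) = 0 := by
      rw [← Matrix.dotProduct_mulVec, Matrix.mulVec_sub, h, sub_self, dotProduct_zero]
    rw [Matrix.sub_vecMul] at h1
    exact h1
  have hnn : ∀ a b : ℝ, 0 ≤ (a - b) * (signedPow r a - signedPow r b) := fun a b => by
    rcases le_total a b with hab | hab
    · exact mul_nonneg_of_nonpos_of_nonpos (by linarith)
        (by linarith [(strictMono_signedPow hr).monotone hab])
    · exact mul_nonneg (by linarith) (by linarith [(strictMono_signedPow hr).monotone hab])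
  rw [Finset.sum_eq_zero_iff_of_nonneg fun i _ => hnn _ _] at hsum
  funext i
  rcases mul_eq_zero.1 (hsum i (Finset.mem_univ i)) with h0 | h0
  · linarith
  · exact (strictMono_signedPow hr).injective (by linarith)

lemma IsBPSolution.sum_le {m N : ℕ} {p : ℝ} (hp : 1 < p) {A : Matrix (Fin m) (Fin N) ℝ}
    {y : Fin m → ℝ} {x : Fin N → ℝ} (hx : IsBPSolution p A y x) (z : Fin N → ℝ)
    (hz : A.mulVec z = y) : ∑ i, |x i| ^ p ≤ ∑ i, |z i| ^ p :=
  (Real.rpow_le_rpow_iff (Finset.sum_nonneg fun i _ => by positivity)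
    (Finset.sum_nonneg fun i _ => by positivity) (by positivity)).1 (hx.2 z hz)

/-- First-order optimality condition. -/
lemma IsBPSolution.exists_eq_dualPoint {m N : ℕ} {p : ℝ} (hp : 1 < p)
    {A : Matrix (Fin m) (Fin N) ℝ} {y : Fin m → ℝ} {x : Fin N → ℝ} (hx : IsBPSolution p A y x) :
    ∃ u, x = dualPoint (1 / (p - 1)) A u := by
  let f : (Fin N → ℝ) →ₗ[ℝ] ℝ :=
    { toFun := fun h => ∑ i, (|x i| ^ (p - 2) * x i) * h i
      map_add' := fun a b => by simp [mul_add, Finset.sum_add_distrib]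
      map_smul' := fun c a => by
        simp only [Pi.smul_apply, smul_eq_mul, RingHom.id_apply, Finset.mul_sum]
        exact Finset.sum_congr rfl fun i _ => by ring }
  -- The gradient functional kills the kernel of `A`, hence factors through `A`; the factor `g`
  -- supplies the multiplier `u`.
  have hf : f ∈ A.mulVecLin.ker.dualAnnihilator := by
    rw [Submodule.mem_dualAnnihilator]
    intro h hh
    have hh' : A.mulVec h = 0 := hh
    have hmin : IsLocalMin (fun t : ℝ => ∑ i, |x i + t * h i| ^ p) 0 := by
      refine Filter.Eventually.of_forall fun t => ?_
      have := hx.sum_le hp (x + t • h) (by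
        rw [Matrix.mulVec_add, Matrix.mulVec_smul, hh', smul_zero, add_zero, hx.1])
      simpa using this
    have hder : HasDerivAt (fun t : ℝ => ∑ i, |x i + t * h i| ^ p)
        (∑ i, p * |x i| ^ (p - 2) * x i * h i) 0 := by
      refine HasDerivAt.fun_sum fun i _ => ?_
      have h1 : HasDerivAt (fun t : ℝ => x i + t * h i) (h i) 0 := by
        simpa using ((hasDerivAt_id (0 : ℝ)).mul_const (h i)).const_add (x i)
      have h2 := hasDerivAt_abs_rpow (x i + 0 * h i) hp
      have h3 := h2.comp (0 : ℝ) h1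
      simp only [zero_mul, add_zero] at h3
      exact h3
    have h0 := hmin.hasDerivAt_eq_zero hder
    have h3 : p * f h = 0 := by
      rw [← h0]
      simp only [f, LinearMap.coe_mk, AddHom.coe_mk, Finset.mul_sum]
      exact Finset.sum_congr rfl fun i _ => by ring
    exact (mul_eq_zero.1 h3).resolve_left (by linarith)
  rw [← LinearMap.range_dualMap_eq_dualAnnihilator_ker] at hf
  obtain ⟨g, hg⟩ := hf
  refine ⟨fun k => g (Pi.single k 1), funext fun i => ?_⟩
  have h1 : |x i| ^ (p - 2) * x i = f (Pi.single i 1) := by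
    simp [f, Pi.single_apply]
  have h2 : f (Pi.single i 1) = Matrix.vecMul (fun k => g (Pi.single k 1)) A i := by
    rw [← hg, LinearMap.dualMap_apply, Matrix.mulVecLin_apply, Matrix.mulVec_single_one,
      LinearMap.pi_apply_eq_sum_univ g]
    refine Finset.sum_congr rfl fun k _ => ?_
    rw [smul_eq_mul, mul_comm]
    congr 2
    ext l
    simp [Pi.single_apply, eq_comm]
  rw [dualPoint, ← h2, ← h1, signedPow_inverse hp]

/-- The `p`-norm dominates the sup norm, so it is coercive on the closed feasible set. -/
lemma exists_isBPSolution {m N : ℕ} {p : ℝ} (hp : 1 < p) (A : Matrix (Fin m) (Fin N) ℝ)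
    (w : Fin N → ℝ) : ∃ x, IsBPSolution p A (A.mulVec w) x := by
  have hp0 : 0 < p := by linarith
  have hcont : Continuous (pNorm (N := N) p) := by
    unfold pNorm
    have h1 := Real.continuous_rpow_const hp0.le
    refine (Real.continuous_rpow_const (q := 1 / p) (by positivity)).comp ?_
    exact continuous_finsetSum _ fun i _ => h1.comp (continuous_abs.comp (continuous_apply i))
  have hle : ∀ x : Fin N → ℝ, ‖x‖ ≤ pNorm p x := fun x => by
    have hnn : 0 ≤ ∑ i, |x i| ^ p := Finset.sum_nonneg fun i _ => by positivity
    refine (pi_norm_le_iff_of_nonneg (by unfold pNorm; positivity)).2 fun i => ?_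
    have h1 : |x i| ^ p ≤ ∑ i, |x i| ^ p :=
      Finset.single_le_sum (f := fun i => |x i| ^ p) (fun i _ => by positivity) (Finset.mem_univ i)
    have h2 := Real.rpow_le_rpow (by positivity) h1 (by positivity : 0 ≤ 1 / p)
    rwa [← Real.rpow_mul (abs_nonneg _), mul_one_div_cancel hp0.ne', Real.rpow_one] at h2
  have hclosed : IsClosed {x : Fin N → ℝ | A.mulVec x = A.mulVec w} :=
    isClosed_eq (Continuous.matrix_mulVec continuous_const continuous_id) continuous_const
  obtain ⟨x, hx, hmin⟩ := hcont.continuousOn.exists_isMinOn' hclosed (x₀ := w) rfl (by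
    refine Filter.Eventually.filter_mono inf_le_left ?_
    have := tendsto_norm_cocompact_atTop (E := Fin N → ℝ)
    exact (this.eventually_ge_atTop (pNorm p w)).mono fun z hz => hz.trans (hle z))
  exact ⟨x, hx, fun z hz => hmin hz⟩

lemma existsUnique_isBPSolution {m N : ℕ} {p : ℝ} (hp : 1 < p) (A : Matrix (Fin m) (Fin N) ℝ)
    (w : Fin N → ℝ) : ∃! x, IsBPSolution p A (A.mulVec w) x := by
  obtain ⟨x, hx⟩ := exists_isBPSolution hp A w
  refine ⟨x, hx, fun z hz => ?_⟩
  obtain ⟨u, rfl⟩ := hx.exists_eq_dualPoint hp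
  obtain ⟨v, rfl⟩ := hz.exists_eq_dualPoint hp
  have hr : 0 < 1 / (p - 1) := by
    have : 0 < p - 1 := by linarith
    positivity
  have := dualPoint_unique hr (hz.1.trans hx.1.symm)
  funext i
  simp only [dualPoint, this]

/-! ### Measurability and null sets -/

/-- Exhausting `u ≠ 0` by the closed conditions `1 / (n + 1) ≤ ‖u‖` writes the set as a countable
union of projections of σ-compact sets. -/
lemma measurableSet_exists_ne_zero {X E : Type*} [TopologicalSpace X] [T2Space X]
    [SigmaCompactSpace X] [MeasurableSpace X] [BorelSpace X] [NormedAddCommGroup E] [ProperSpace E]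
    {C : Set (X × E)} (hC : IsClosed C) : MeasurableSet {x | ∃ u, u ≠ 0 ∧ (x, u) ∈ C} := by
  have h1 : {x | ∃ u, u ≠ 0 ∧ (x, u) ∈ C} =
      ⋃ n : ℕ, Prod.fst '' (C ∩ {q : X × E | 1 / ((n : ℝ) + 1) ≤ ‖q.2‖}) := by
    ext x
    simp only [Set.mem_ofPred_eq, Set.mem_iUnion, Set.mem_image, Set.mem_inter_iff, Prod.exists,
      exists_and_right, exists_eq_right]
    constructor
    · rintro ⟨u, hu, hxu⟩
      obtain ⟨n, hn⟩ := exists_nat_one_div_lt (norm_pos_iff.2 hu)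
      exact ⟨n, u, hxu, hn.le⟩
    · rintro ⟨n, u, hxu, hn⟩
      exact ⟨u, norm_pos_iff.1 (lt_of_lt_of_le (by positivity) hn), hxu⟩
  rw [h1]
  refine MeasurableSet.iUnion fun n => ?_
  have h2 : IsClosed (C ∩ {q : X × E | 1 / ((n : ℝ) + 1) ≤ ‖q.2‖}) :=
    hC.inter (isClosed_le continuous_const continuous_snd.norm)
  obtain ⟨K, hK, hKu⟩ :=
    (isSigmaCompact_univ.of_isClosed_subset h2 (Set.subset_univ _)).image continuous_fst
  rw [← hKu]
  exact MeasurableSet.iUnion fun k => (hK k).measurableSet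

/-- Sums of signed powers of linear forms map null sets to null sets. -/
lemma volume_image_sum_signedPow_eq_zero {ι : Type*} [Fintype ι] {m : ℕ} {r : ℝ} (hr : 0 < r)
    (f : ι → (Fin m → ℝ) →L[ℝ] ℝ) (d : ι → Fin m → ℝ) (c : Fin m → ℝ)
    {S : Set (Fin m → ℝ)} (hS : volume S = 0) :
    volume ((fun u => c + ∑ i, signedPow r (f i u) • d i) '' S) = 0 := by
  classical
  -- For `r < 1` the signed power is not differentiable at `0`. Stratifying by which forms vanish
  -- leaves only terms differentiable on each stratum.
  let T : Finset ι → Set (Fin m → ℝ) := fun J => {u | ∀ i, f i u ≠ 0 ↔ i ∈ J}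
  have hcover : S ⊆ ⋃ J, S ∩ T J := fun u hu =>
    Set.mem_iUnion.2 ⟨Finset.univ.filter fun i => f i u ≠ 0, hu, by simp [T]⟩
  refine measure_mono_null (Set.image_mono hcover) ?_
  rw [Set.image_iUnion]
  refine measure_iUnion_null fun J => ?_
  have heq : Set.EqOn (fun u => c + ∑ i, signedPow r (f i u) • d i)
      (fun u => c + ∑ i ∈ J, signedPow r (f i u) • d i) (S ∩ T J) := by
    intro u hu
    simp only
    congr 1
    refine (Finset.sum_subset (Finset.subset_univ J) fun i _ hi => ?_).symm
    rw [not_ne_iff.1 (mt (hu.2 i).1 hi), signedPow_zero, zero_smul]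
  rw [heq.image_eq]
  refine addHaar_image_eq_zero_of_differentiableOn_of_addHaar_eq_zero _ ?_
    (measure_mono_null Set.inter_subset_left hS)
  intro u hu
  refine DifferentiableAt.differentiableWithinAt ?_
  refine (differentiableAt_const c).add (DifferentiableAt.fun_sum fun i hi => ?_)
  exact ((differentiableAt_signedPow hr.ne' ((hu.2 i).2 hi)).comp u
    (f i).differentiableAt).smul_const _

lemma convexOn_abs_rpow {q : ℝ} (hq : 1 ≤ q) : ConvexOn ℝ Set.univ fun t : ℝ => |t| ^ q := by
  refine ⟨convex_univ, fun x _ y _ a b ha hb hab => ?_⟩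
  have h1 : |a • x + b • y| ≤ a • |x| + b • |y| := by
    refine (abs_add_le _ _).trans ?_
    simp [abs_mul, abs_of_nonneg ha, abs_of_nonneg hb]
  exact (Real.rpow_le_rpow (abs_nonneg _) h1 (by linarith)).trans
    ((convexOn_rpow hq).2 (abs_nonneg x) (abs_nonneg y) ha hb hab)

/-- The nonzero solutions of `∑ i, |f i u| ^ q = ℓ u` form a null set. -/
lemma volume_sum_abs_rpow_eq_linear {ι : Type*} [Fintype ι] {m : ℕ} {q : ℝ} (hq : 1 < q)
    (f : ι → (Fin m → ℝ) →L[ℝ] ℝ) (l : (Fin m → ℝ) →L[ℝ] ℝ)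
    (hf : ∀ u, (∀ i, f i u = 0) → u = 0) :
    volume {u : Fin m → ℝ | u ≠ 0 ∧ ∑ i, |f i u| ^ q = l u} = 0 := by
  let h : (Fin m → ℝ) → ℝ := fun u => ∑ i, |f i u| ^ q - l u
  have hconv : Convex ℝ {u | h u ≤ 0} := by
    have h1 : ConvexOn ℝ Set.univ h := by
      refine ConvexOn.sub ?_ (l.toLinearMap.concaveOn convex_univ)
      refine ⟨convex_univ, fun x _ y _ a b ha hb hab => ?_⟩
      simp only [Finset.smul_sum, ← Finset.sum_add_distrib]
      refine Finset.sum_le_sum fun i _ => ?_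
      rw [map_add, map_smul, map_smul]
      exact (convexOn_abs_rpow hq.le).2 trivial trivial ha hb hab
    simpa using h1.convex_le 0
  -- A nonzero solution lies on the frontier of the convex set: scaling it by any `t > 1` makes `h`
  -- positive, since `t ^ q > t`.
  refine measure_mono_null ?_ (hconv.addHaar_frontier volume)
  rintro u ⟨hu, hu'⟩
  have hmem : u ∈ {u | h u ≤ 0} := by simp [h, hu']
  refine ⟨subset_closure hmem, fun hint => ?_⟩
  have hpos : 0 < ∑ i, |f i u| ^ q := by
    have h0 : ∃ i, f i u ≠ 0 := by
      by_contra! hc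
      exact hu (hf u hc)
    obtain ⟨i, hi⟩ := h0
    exact Finset.sum_pos' (fun i _ => by positivity) ⟨i, Finset.mem_univ i, by positivity⟩
  have hev : ∀ᶠ t : ℝ in nhds 1, t • u ∈ {u | h u ≤ 0} := by
    have hc : ContinuousAt (fun t : ℝ => t • u) 1 := by fun_prop
    refine (hc.eventually_mem (s := interior {u | h u ≤ 0}) ?_).mono fun t ht => interior_subset ht
    rw [one_smul]
    exact isOpen_interior.mem_nhds hint
  obtain ⟨t, ht, ht1⟩ :=
    ((hev.filter_mono nhdsWithin_le_nhds).and (self_mem_nhdsWithin (s := Set.Ioi (1 : ℝ)))).exists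
  have ht1' : (1 : ℝ) < t := ht1
  have h2 : h (t • u) = (t ^ q - t) * ∑ i, |f i u| ^ q := by
    simp only [h, map_smul, smul_eq_mul, abs_mul, abs_of_pos (by linarith : (0 : ℝ) < t)]
    rw [← hu', sub_mul, Finset.mul_sum, Finset.mul_sum]
    congr 1
    exact Finset.sum_congr rfl fun i _ => Real.mul_rpow (by linarith) (abs_nonneg _)
  have h3 : t < t ^ q := by
    simpa using Real.rpow_lt_rpow_of_exponent_lt ht1' hq
  have h4 : 0 < h (t • u) := by
    rw [h2]
    exact mul_pos (by linarith) hpos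
  exact absurd ht (not_le.2 h4)

/-- Adding `t` times the identity in the columns `e` turns the determinant into a characteristic
polynomial in `t`, with finitely many roots. -/
lemma ae_det_submatrix_ne_zero {m N : ℕ} (e : Fin m → Fin N) (he : Function.Injective e) :
    ∀ᵐ a : Fin m → Fin N → ℝ, ((Matrix.of a).submatrix id e).det ≠ 0 := by
  classical
  let B : Fin m → Fin N → ℝ := fun k i => if e k = i then 1 else 0
  have hmeas : MeasurableSet {a : Fin m → Fin N → ℝ | ((Matrix.of a).submatrix id e).det ≠ 0} := by
    have hc : Continuous fun a : Fin m → Fin N → ℝ => ((Matrix.of a).submatrix id e).det := by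
      refine Continuous.matrix_det ?_
      refine continuous_matrix fun k l => ?_
      simp only [Matrix.submatrix_apply, Matrix.of_apply]
      fun_prop
    exact (isOpen_ne_fun hc continuous_const).measurableSet
  refine ae_mem_of_ae_add_linearMap_mem (LinearMap.toSpanSingleton ℝ _ B) volume volume hmeas
    fun a => ?_
  let P := (-(Matrix.of a).submatrix id e).charpoly
  have hfin : {t : ℝ | P.IsRoot t}.Finite :=
    Polynomial.finite_setOfPred_isRoot (Matrix.charpoly_monic _).ne_zero
  refine measure_mono_null ?_ (hfin.measure_zero volume)
  intro t ht
  have ht' := not_not.1 ht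
  change Polynomial.eval t P = 0
  rw [Matrix.eval_charpoly, ← ht']
  congr 1
  ext k l
  simp [B, Matrix.scalar_apply, Matrix.diagonal_apply, he.eq_iff, add_comm, eq_comm]

lemma eq_zero_of_vecMul_eq_zero_of_det_ne_zero {m N : ℕ} {A : Matrix (Fin m) (Fin N) ℝ}
    {e : Fin m → Fin N} (hA : (A.submatrix id e).det ≠ 0) {u : Fin m → ℝ}
    (hu : ∀ k, Matrix.vecMul u A (e k) = 0) : u = 0 :=
  Matrix.eq_zero_of_vecMul_eq_zero hA (funext hu)

/-! ### Dual zeros for a fixed coefficient vector -/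

/-- Some nonzero dual vector `u` whose `j`-th correlation with the columns of `A` vanishes is mapped
to `y` by the dual parametrization. -/
def HasDualZero {m N : ℕ} (r : ℝ) (j : Fin N) (A : Matrix (Fin m) (Fin N) ℝ) (y : Fin m → ℝ) :
    Prop :=
  ∃ u, u ≠ 0 ∧ Matrix.vecMul u A j = 0 ∧ A.mulVec (dualPoint r A u) = y

lemma continuous_vecMul_of {m N : ℕ} :
    Continuous fun q : (Fin m → Fin N → ℝ) × (Fin m → ℝ) => Matrix.vecMul q.2 (Matrix.of q.1) := by
  refine continuous_pi fun i => ?_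
  simp only [Matrix.vecMul, dotProduct, Matrix.of_apply]
  fun_prop

lemma continuous_mulVec_of {m N : ℕ} :
    Continuous fun q : (Fin m → Fin N → ℝ) × (Fin N → ℝ) => (Matrix.of q.1).mulVec q.2 := by
  refine continuous_pi fun i => ?_
  simp only [Matrix.mulVec, dotProduct, Matrix.of_apply]
  fun_prop

lemma continuous_mulVec_dualPoint {m N : ℕ} {r : ℝ} (hr : 0 < r) :
    Continuous fun q : (Fin m → Fin N → ℝ) × (Fin m → ℝ) =>
      (Matrix.of q.1).mulVec (dualPoint r (Matrix.of q.1) q.2) := by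
  refine continuous_mulVec_of.comp (continuous_fst.prodMk (continuous_pi fun i => ?_))
  exact (continuous_signedPow hr).comp ((continuous_apply i).comp continuous_vecMul_of)

lemma measurableSet_hasDualZero {m N : ℕ} {r : ℝ} (hr : 0 < r) (j : Fin N) {X : Type*}
    [TopologicalSpace X] [T2Space X] [SigmaCompactSpace X] [MeasurableSpace X] [BorelSpace X]
    {a : X → Fin m → Fin N → ℝ} (ha : Continuous a) {y : X → Fin m → ℝ} (hy : Continuous y) :
    MeasurableSet {x | HasDualZero r j (Matrix.of (a x)) (y x)} := by
  have h1 : IsClosed {q : X × (Fin m → ℝ) | Matrix.vecMul q.2 (Matrix.of (a q.1)) j = 0 ∧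
      (Matrix.of (a q.1)).mulVec (dualPoint r (Matrix.of (a q.1)) q.2) = y q.1} := by
    have h2 : Continuous fun q : X × (Fin m → ℝ) => (a q.1, q.2) :=
      (ha.comp continuous_fst).prodMk continuous_snd
    exact (isClosed_eq ((continuous_apply j).comp (continuous_vecMul_of.comp h2))
      continuous_const).inter
      (isClosed_eq ((continuous_mulVec_dualPoint hr).comp h2) (hy.comp continuous_fst))
  exact measurableSet_exists_ne_zero h1

lemma mulVec_dualPoint_eq_sum {m N : ℕ} (r : ℝ) (B : Matrix (Fin m) (Fin N) ℝ) (u : Fin m → ℝ) :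
    B.mulVec (dualPoint r B u) = ∑ i, signedPow r (Matrix.vecMul u B i) • fun k => B k i := by
  ext k
  simp [Matrix.mulVec, dotProduct, dualPoint, mul_comm]

/-- The columns `c` which, inserted in the `j`-th place of `B`, produce a dual zero for the image of
`w`, form a null set. -/
lemma volume_column_hasDualZero {m N : ℕ} {r : ℝ} (hr : 0 < r) {B : Matrix (Fin m) (Fin N) ℝ}
    (hB : ∀ u, Matrix.vecMul u B = 0 → u = 0) (w : Fin N → ℝ) (t : ℝ) :
    volume {c : Fin m → ℝ | ∃ u, u ≠ 0 ∧ u ⬝ᵥ c = 0 ∧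
      B.mulVec (dualPoint r B u) = B.mulVec w + t • c} = 0 := by
  have hlin : ∀ v : Fin m → ℝ, ∃ l : (Fin m → ℝ) →L[ℝ] ℝ, ∀ u, l u = u ⬝ᵥ v := fun v =>
    ⟨∑ k, v k • ContinuousLinearMap.proj k, fun u => by simp [dotProduct, mul_comm]⟩
  rcases eq_or_ne t 0 with rfl | ht
  -- Here the equation no longer involves `c`, so `u` is unique and `c` must be orthogonal to it.
  · simp only [zero_smul, add_zero]
    by_cases hex : ∃ u, u ≠ 0 ∧ B.mulVec (dualPoint r B u) = B.mulVec w
    · obtain ⟨v, hv, hv'⟩ := hex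
      obtain ⟨l, hl⟩ := hlin v
      have hker : volume ((l.toLinearMap.ker : Submodule ℝ (Fin m → ℝ)) : Set (Fin m → ℝ)) = 0 := by
        refine Measure.addHaar_submodule volume _ fun htop => hv ?_
        have : l v = 0 := by
          have : v ∈ l.toLinearMap.ker := htop ▸ Submodule.mem_top
          exact this
        rw [hl] at this
        exact dotProduct_self_eq_zero.1 this
      refine measure_mono_null ?_ hker
      rintro c ⟨u, hu, huc, hu'⟩
      have huv : u = v := by
        refine sub_eq_zero.1 (hB _ ?_)
        rw [Matrix.sub_vecMul, dualPoint_unique hr (hu'.trans hv'.symm), sub_self]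
      change l c = 0
      rw [hl, dotProduct_comm, ← huv, huc]
    · convert measure_empty (μ := (volume : Measure (Fin m → ℝ)))
      refine Set.eq_empty_of_forall_notMem ?_
      rintro c ⟨u, hu, -, hu'⟩
      exact hex ⟨u, hu, hu'⟩
  -- Solving for `c` makes it a signed-power function of `u`; orthogonality becomes `∑ i, |f i u| ^
  -- (r + 1) = l u`.
  · choose f hf using fun i => hlin fun k => B k i
    have hf' : ∀ i u, f i u = Matrix.vecMul u B i := fun i u => hf i u
    obtain ⟨l, hl⟩ := hlin (B.mulVec w)
    have hnull : volume {u : Fin m → ℝ | u ≠ 0 ∧ ∑ i, |f i u| ^ (r + 1) = l u} = 0 :=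
      volume_sum_abs_rpow_eq_linear (by linarith) f l fun u hu =>
        hB u (funext fun i => by rw [← hf', hu]; rfl)
    have himg := volume_image_sum_signedPow_eq_zero hr f (fun i k => t⁻¹ * B k i)
      (-(t⁻¹ • B.mulVec w)) hnull
    refine measure_mono_null ?_ himg
    rintro c ⟨u, hu, huc, hu'⟩
    refine ⟨u, ⟨hu, ?_⟩, ?_⟩
    · have h1 : u ⬝ᵥ B.mulVec (dualPoint r B u) = l u := by
        rw [hu', dotProduct_add, dotProduct_smul, huc, smul_zero, add_zero, hl]
      rw [← h1, Matrix.dotProduct_mulVec, dotProduct]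
      refine Finset.sum_congr rfl fun i _ => ?_
      rw [hf', dualPoint, mul_signedPow hr]
    · have h2 : ∑ i, signedPow r (f i u) • (fun k => t⁻¹ * B k i) =
          t⁻¹ • B.mulVec (dualPoint r B u) := by
        rw [mulVec_dualPoint_eq_sum, Finset.smul_sum]
        refine Finset.sum_congr rfl fun i _ => ?_
        rw [hf']
        ext k
        simp
        ring
      simp only [h2]
      rw [hu', smul_add, smul_smul, inv_mul_cancel₀ ht, one_smul, neg_add_cancel_left]

/-- It suffices to slice along translations of column `j`. As `e` avoids `j`, the minor is constant
on each slice: either it is zero and the slice is vacuous, or the null-column estimate applies. -/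
lemma ae_not_hasDualZero {m N : ℕ} {r : ℝ} (hr : 0 < r) (j : Fin N) {e : Fin m → Fin N}
    (he : Function.Injective e) (hej : ∀ k, e k ≠ j) (w : Fin N → ℝ) :
    ∀ᵐ a : Fin m → Fin N → ℝ, ¬ HasDualZero r j (Matrix.of a) ((Matrix.of a).mulVec w) := by
  classical
  have hdet : Continuous fun a : Fin m → Fin N → ℝ => ((Matrix.of a).submatrix id e).det := by
    refine Continuous.matrix_det (continuous_matrix fun k l => ?_)
    simp only [Matrix.submatrix_apply, Matrix.of_apply]
    fun_prop
  have hmeas : MeasurableSet {a : Fin m → Fin N → ℝ | ((Matrix.of a).submatrix id e).det ≠ 0 →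
      ¬ HasDualZero r j (Matrix.of a) ((Matrix.of a).mulVec w)} := by
    have h1 := (isOpen_ne_fun hdet (continuous_const (y := (0 : ℝ)))).measurableSet
    have h2 := measurableSet_hasDualZero hr j (a := fun a : Fin m → Fin N → ℝ => a) continuous_id
      (continuous_mulVec_of.comp (continuous_id.prodMk (continuous_const (y := w))))
    exact h1.imp h2.compl
  let L : (Fin m → ℝ) →ₗ[ℝ] (Fin m → Fin N → ℝ) :=
    { toFun := fun v k i => if i = j then v k else 0
      map_add' := fun a b => by ext k i; by_cases h : i = j <;> simp [h]
      map_smul' := fun c a => by ext k i; by_cases h : i = j <;> simp [h] }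
  have hmain : ∀ᵐ a : Fin m → Fin N → ℝ, ((Matrix.of a).submatrix id e).det ≠ 0 →
      ¬ HasDualZero r j (Matrix.of a) ((Matrix.of a).mulVec w) := by
    refine ae_mem_of_ae_add_linearMap_mem L volume volume hmeas fun a => ?_
    let B : Matrix (Fin m) (Fin N) ℝ := Matrix.of fun k i => if i = j then 0 else a k i
    let b : Fin m → ℝ := fun k => a k j
    have hdec : ∀ v, Matrix.of (a + L v) = B + Matrix.vecMulVec (b + v) (Pi.single j 1) := by
      intro v
      ext k i
      by_cases h : i = j <;> simp [L, B, b, h, Matrix.vecMulVec_apply]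
    have hBj : ∀ u, Matrix.vecMul u B j = 0 := fun u => by
      simp [B, Matrix.vecMul, dotProduct]
    by_cases hBdet : (B.submatrix id e).det = 0
    · refine Filter.Eventually.of_forall fun v hv => absurd ?_ hv
      rw [← hBdet]
      congr 1
      ext k l
      simp [L, B, hej]
    have hnull := volume_column_hasDualZero hr (B := B) (fun u hu =>
      eq_zero_of_vecMul_eq_zero_of_det_ne_zero hBdet fun k => congrFun hu (e k)) w (w j)
    have hae := measure_preimage_add (volume : Measure (Fin m → ℝ)) b _ ▸ hnull
    refine measure_mono_null ?_ hae
    intro v hv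
    have hv' : HasDualZero r j (Matrix.of (a + L v)) ((Matrix.of (a + L v)).mulVec w) := by
      by_contra hcon
      exact hv fun _ => hcon
    obtain ⟨u, hu, huj, hu'⟩ := hv'
    have hmul : ∀ x : Fin N → ℝ,
        (Matrix.of (a + L v)).mulVec x = B.mulVec x + x j • (b + v) := fun x => by
      rw [hdec, Matrix.add_mulVec]
      congr 1
      ext k
      simp [Matrix.mulVec, Matrix.vecMulVec_apply, dotProduct, Pi.single_apply, mul_comm]
    have hvec : Matrix.vecMul u (Matrix.of (a + L v)) =
        Matrix.vecMul u B + (u ⬝ᵥ (b + v)) • Pi.single j 1 := by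
      rw [hdec, Matrix.vecMul_add, Matrix.vecMul_vecMulVec]
    have hz : u ⬝ᵥ (b + v) = 0 := by
      simpa [hvec, hBj] using huj
    have hdual : dualPoint r (Matrix.of (a + L v)) u = dualPoint r B u := by
      ext i
      rw [dualPoint, dualPoint, hvec, hz, zero_smul, add_zero]
    refine ⟨u, hu, hz, ?_⟩
    rw [hmul, hmul, hdual] at hu'
    rw [← hu', dualPoint, hBj, signedPow_zero, zero_smul, add_zero]
  filter_upwards [hmain, ae_det_submatrix_ne_zero e he] with a h1 h2 using h1 h2

/-! ### Full spark matrices -/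

/-- All maximal minors of `A` are nonzero. -/
def FullSpark {m N : ℕ} (A : Matrix (Fin m) (Fin N) ℝ) : Prop :=
  ∀ e : Fin m ↪ Fin N, (A.submatrix id e).det ≠ 0

lemma ae_fullSpark (m N : ℕ) : ∀ᵐ a : Fin m → Fin N → ℝ, FullSpark (Matrix.of a) :=
  ae_all_iff.2 fun e => ae_det_submatrix_ne_zero e e.injective

lemma signedPow_eq_zero_iff {r : ℝ} (hr : 0 < r) {t : ℝ} : signedPow r t = 0 ↔ t = 0 := by
  simpa [signedPow_zero] using (strictMono_signedPow hr).injective.eq_iff (a := t) (b := 0)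

lemma FullSpark.le_suppCard_dualPoint {m N : ℕ} {r : ℝ} (hr : 0 < r) (hmN : m ≤ N)
    {A : Matrix (Fin m) (Fin N) ℝ} (hA : FullSpark A) {u : Fin m → ℝ} (hu : u ≠ 0) :
    N - m + 1 ≤ suppCard (dualPoint r A u) := by
  classical
  let Z : Finset (Fin N) := Finset.univ.filter fun i => Matrix.vecMul u A i = 0
  have hZ : Z.card < m := by
    by_contra! hle
    obtain ⟨e⟩ : Nonempty (Fin m ↪ Z) :=
      Function.Embedding.nonempty_of_card_le (by simpa using hle)
    refine hu (eq_zero_of_vecMul_eq_zero_of_det_ne_zero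
      (hA (e.trans (Function.Embedding.subtype _))) fun k => ?_)
    exact (Finset.mem_filter.1 (e k).2).2
  have hsupp : Function.support (dualPoint r A u) = ((Zᶜ : Finset (Fin N)) : Set (Fin N)) := by
    ext i
    simp [Z, dualPoint, signedPow_eq_zero_iff hr]
  rw [suppCard, hsupp, Set.ncard_coe_finset, Finset.card_compl, Fintype.card_fin]
  omega

/-! ### Almost every point of a column range -/

/-- Extension by zero of a vector indexed by `I`. -/
noncomputable def extendByZero {N : ℕ} (I : Finset (Fin N)) (z : EuclideanSpace ℝ I) :
    Fin N → ℝ :=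
  fun i => if h : i ∈ I then z ⟨i, h⟩ else 0

lemma toEuclideanLin_colSubmatrix {m N : ℕ} (A : Matrix (Fin m) (Fin N) ℝ) (I : Finset (Fin N))
    (z : EuclideanSpace ℝ I) :
    (Matrix.toEuclideanLin (colSubmatrix A I) z).ofLp = A.mulVec (extendByZero I z) := by
  ext k
  simp only [Matrix.toLpLin_apply, Matrix.mulVec, dotProduct, colSubmatrix, Matrix.submatrix_apply,
    id_eq, extendByZero]
  rw [← Finset.sum_subset (Finset.subset_univ I) fun i _ hi => by simp [hi],
    ← Finset.sum_coe_sort I]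
  exact Finset.sum_congr rfl fun i _ => by simp

lemma exists_mulVec_eq_of_mem_colRange {m N : ℕ} {A : Matrix (Fin m) (Fin N) ℝ}
    {I : Finset (Fin N)} {y : EuclideanSpace ℝ (Fin m)} (hy : y ∈ colRange A I) :
    ∃ w, A.mulVec w = y.ofLp := by
  obtain ⟨z, rfl⟩ := hy
  exact ⟨_, (toEuclideanLin_colSubmatrix A I z).symm⟩

lemma continuous_extendByZero {N : ℕ} (I : Finset (Fin N)) : Continuous (extendByZero I) := by
  refine continuous_pi fun i => ?_
  unfold extendByZero
  by_cases h : i ∈ I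
  · simp only [h, dite_true]
    fun_prop
  · simp only [h, dite_false]
    fun_prop

/-- Fubini turns "each `z`, almost every `A`" into "almost every `A`, almost every `z`"; null sets
then pass along the surjection from coefficients to the column range. -/
lemma ae_ae_colRange_not_hasDualZero {m N : ℕ} {r : ℝ} (hr : 0 < r) (j : Fin N)
    {e : Fin m → Fin N} (he : Function.Injective e) (hej : ∀ k, e k ≠ j) (I : Finset (Fin N)) :
    ∀ᵐ a : Fin m → Fin N → ℝ, ∀ᵐ y : colRange (Matrix.of a) I,
      ¬ HasDualZero r j (Matrix.of a) y.val.ofLp := by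
  have hmeas : MeasurableSet {q : (Fin m → Fin N → ℝ) × EuclideanSpace ℝ I |
      ¬ HasDualZero r j (Matrix.of q.1) ((Matrix.of q.1).mulVec (extendByZero I q.2))} :=
    (measurableSet_hasDualZero hr j continuous_fst (continuous_mulVec_of.comp
      (continuous_fst.prodMk ((continuous_extendByZero I).comp continuous_snd)))).compl
  have h1 := (Measure.ae_ae_comm (μ := (volume : Measure (Fin m → Fin N → ℝ)))
    (ν := (volume : Measure (EuclideanSpace ℝ I))) hmeas).2
    (Filter.Eventually.of_forall fun z => ae_not_hasDualZero hr j he hej (extendByZero I z))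
  filter_upwards [h1] with a ha
  let L : EuclideanSpace ℝ I →ₗ[ℝ] colRange (Matrix.of a) I :=
    (Matrix.toEuclideanLin (colSubmatrix (Matrix.of a) I)).rangeRestrict
  have hm : MeasurableSet {y : colRange (Matrix.of a) I |
      ¬ HasDualZero r j (Matrix.of a) y.val.ofLp} :=
    (measurableSet_hasDualZero hr j (a := fun _ : colRange (Matrix.of a) I => a) continuous_const
      ((PiLp.continuous_ofLp 2 _).comp continuous_subtype_val)).compl
  refine (ae_comp_linearMap_mem_iff L volume volume (LinearMap.surjective_rangeRestrict _) hm).1 ?_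
  filter_upwards [ha] with z hz
  change ¬ HasDualZero r j (Matrix.of a) (Matrix.toEuclideanLin (colSubmatrix (Matrix.of a) I) z).ofLp
  rwa [toEuclideanLin_colSubmatrix]

/-- Nontriviality ensures that `{0}` is null in the column range. It holds because a zero column
would lie in a vanishing maximal minor. -/
lemma FullSpark.nontrivial_colRange {m N : ℕ} (hm : 1 ≤ m) (hmN : m ≤ N)
    {A : Matrix (Fin m) (Fin N) ℝ} (hA : FullSpark A) {I : Finset (Fin N)} (hI : I.Nonempty) :
    Nontrivial (colRange A I) := by
  classical
  obtain ⟨i, hi⟩ := hI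
  let z : EuclideanSpace ℝ I := EuclideanSpace.single ⟨i, hi⟩ 1
  refine ⟨⟨Matrix.toEuclideanLin (colSubmatrix A I) z, z, rfl⟩, 0, fun h => ?_⟩
  have h0 : A.mulVec (extendByZero I z) = 0 := by
    rw [← toEuclideanLin_colSubmatrix]
    exact congrArg (fun y : colRange A I => y.val.ofLp) h
  have hext : extendByZero I z = Pi.single i 1 := by
    ext l
    by_cases hl : l ∈ I
    · simp [extendByZero, z, hl, Pi.single_apply]
    · have : l ≠ i := fun h => hl (h ▸ hi)
      simp [extendByZero, hl, this]
  rw [hext, Matrix.mulVec_single_one] at h0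
  let e0 : Fin m ↪ Fin N := Fin.castLEEmb hmN
  let k0 : Fin m := ⟨0, hm⟩
  let e : Fin m ↪ Fin N := e0.trans (Equiv.swap (e0 k0) i).toEmbedding
  refine hA e (Matrix.det_eq_zero_of_column_eq_zero k0 fun k => ?_)
  have : e k0 = i := Equiv.swap_apply_left (e0 k0) i
  rw [Matrix.submatrix_apply, this]
  exact congrFun h0 k

lemma exists_injective_ne {m N : ℕ} (h : m < N) (j : Fin N) :
    ∃ e : Fin m → Fin N, Function.Injective e ∧ ∀ k, e k ≠ j := by
  obtain ⟨e⟩ : Nonempty (Fin m ↪ {i : Fin N // i ≠ j}) :=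
    Function.Embedding.nonempty_of_card_le (by simp; omega)
  exact ⟨fun k => (e k).1, fun a b hab => e.injective (Subtype.ext hab), fun k => (e k).2⟩

/-- For a full spark matrix, the support of a solution for nonzero data has size more than
`N - m`. -/
lemma FullSpark.le_suppCard_of_isBPSolution {m N : ℕ} {p : ℝ} (hp : 1 < p) (hmN : m ≤ N)
    {A : Matrix (Fin m) (Fin N) ℝ} (hA : FullSpark A) {y : Fin m → ℝ} (hy : y ≠ 0)
    {x : Fin N → ℝ} (hx : IsBPSolution p A y x) : N - m + 1 ≤ suppCard x := by
  have hr : 0 < 1 / (p - 1) := one_div_pos.2 (by linarith)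
  obtain ⟨u, rfl⟩ := hx.exists_eq_dualPoint hp
  refine hA.le_suppCard_dualPoint hr hmN fun hu => hy ?_
  rw [← hx.1, hu, show dualPoint (1 / (p - 1)) A 0 = 0 from
    funext fun i => by simp [dualPoint, signedPow_zero], Matrix.mulVec_zero]

lemma suppCard_eq_of_not_hasDualZero {m N : ℕ} {p : ℝ} (hp : 1 < p)
    {A : Matrix (Fin m) (Fin N) ℝ} {y : Fin m → ℝ} (hy : y ≠ 0)
    (hA : ∀ j, ¬ HasDualZero (1 / (p - 1)) j A y) {x : Fin N → ℝ} (hx : IsBPSolution p A y x) :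
    suppCard x = N := by
  have hr : 0 < 1 / (p - 1) := one_div_pos.2 (by linarith)
  obtain ⟨u, rfl⟩ := hx.exists_eq_dualPoint hp
  have hu : u ≠ 0 := fun hu => hy <| by
    rw [← hx.1, hu, show dualPoint (1 / (p - 1)) A 0 = 0 from
      funext fun i => by simp [dualPoint, signedPow_zero], Matrix.mulVec_zero]
  have hsupp : Function.support (dualPoint (1 / (p - 1)) A u) = Set.univ :=
    Set.eq_univ_of_forall fun j hj =>
      hA j ⟨u, hu, (signedPow_eq_zero_iff hr).1 hj, hx.1⟩
  rw [suppCard, hsupp, Set.ncard_univ, Nat.card_fin]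

theorem mainTheorem8 (p : ℝ) (hp : 1 < p) (m N s : ℕ) (hm : 1 ≤ m) (hN : 2 * m ≤ N + 1)
    (hs : 1 ≤ s) (hsN : s ≤ N) :
    (∃ S : Set (Matrix (Fin m) (Fin N) ℝ), HasNullComplement S ∧
      ∀ A ∈ S, ∀ I : Finset (Fin N), I.card ≤ s →
        ∀ y ∈ colRange A I, y ≠ 0 →
          (∃! x : Fin N → ℝ, IsBPSolution p A y.ofLp x) ∧
          ∀ x : Fin N → ℝ, IsBPSolution p A y.ofLp x → N - m + 1 ≤ suppCard x) ∧
    (∃ S : Set (Matrix (Fin m) (Fin N) ℝ), HasNullComplement S ∧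
      ∀ A ∈ S, ∀ I : Finset (Fin N), I.Nonempty → I.card ≤ s →
        ∀ᵐ y : colRange A I ∂volume,
          (∃! x : Fin N → ℝ, IsBPSolution p A y.val.ofLp x) ∧
          ∀ x : Fin N → ℝ, IsBPSolution p A y.val.ofLp x → suppCard x = N) := by
  have hmN : m ≤ N := by omega
  have hr : 0 < 1 / (p - 1) := one_div_pos.2 (by linarith)
  have hne : ∀ y : EuclideanSpace ℝ (Fin m), y ≠ 0 → y.ofLp ≠ 0 := fun y hy h =>
    hy (PiLp.ext fun i => congrFun h i)
  have huniq : ∀ (A : Matrix (Fin m) (Fin N) ℝ) (I : Finset (Fin N)), ∀ y ∈ colRange A I,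
      ∃! x : Fin N → ℝ, IsBPSolution p A y.ofLp x := fun A I y hy => by
    obtain ⟨w, hw⟩ := exists_mulVec_eq_of_mem_colRange hy
    exact hw ▸ existsUnique_isBPSolution hp A w
  refine ⟨⟨{A | FullSpark A}, ae_fullSpark m N, fun A hA I _ y hy hy0 =>
    ⟨huniq A I y hy, fun x hx => FullSpark.le_suppCard_of_isBPSolution hp hmN hA (hne y hy0) hx⟩⟩,
    -- The guard `m < N` is what allows `m` columns to be chosen away from `j`.
    ⟨{A | FullSpark A ∧ ∀ I : Finset (Fin N), ∀ j, m < N → ∀ᵐ y : colRange A I,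
      ¬ HasDualZero (1 / (p - 1)) j A y.val.ofLp}, ?_, ?_⟩⟩
  · have h1 : ∀ᵐ a : Fin m → Fin N → ℝ, ∀ I : Finset (Fin N), ∀ j, m < N →
        ∀ᵐ y : colRange (Matrix.of a) I,
          ¬ HasDualZero (1 / (p - 1)) j (Matrix.of a) y.val.ofLp := by
      refine ae_all_iff.2 fun I => ae_all_iff.2 fun j => ?_
      by_cases h : m < N
      · obtain ⟨e, he, hej⟩ := exists_injective_ne h j
        filter_upwards [ae_ae_colRange_not_hasDualZero hr j he hej I] with a ha _ using ha
      · exact Filter.Eventually.of_forall fun a h' => absurd h' h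
    exact (ae_fullSpark m N).and h1
  · rintro A ⟨hA, hA'⟩ I hI -
    have := FullSpark.nontrivial_colRange hm hmN hA hI
    have h0 : ∀ᵐ y : colRange A I, y ≠ 0 :=
      measure_mono_null (by simp) (measure_singleton (0 : colRange A I))
    rcases hmN.lt_or_eq with hlt | heq
    · filter_upwards [h0, ae_all_iff.2 fun j => hA' I j hlt] with y hy0 hy
      exact ⟨huniq A I y y.2, fun x hx => suppCard_eq_of_not_hasDualZero hp
        (hne _ fun h => hy0 (Subtype.ext h)) hy hx⟩
    -- With `m = N`, the bound `2 * m ≤ N + 1` forces `N = 1`, so `N - m + 1` is already `N`.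
    · filter_upwards [h0] with y hy0
      refine ⟨huniq A I y y.2, fun x hx => le_antisymm ?_ ?_⟩
      · exact (Set.ncard_le_card _).trans_eq (by simp)
      · have := FullSpark.le_suppCard_of_isBPSolution hp hmN hA
          (hne _ fun h => hy0 (Subtype.ext h)) hx
        omega
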